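/- Let $N \ge 1$ be an integer, write $\mathrm{e}(x)=e^{2\pi \mathrm{i} x}$, let $\overline{\mathcal F} = \{z\in\mathbf{C} : \mathrm{Im}(z)>0,\ |z|\ge 1,\ |\mathrm{Re}(z)|\le 1/2\}$ be the closure of the standard fundamental domain of $\mathrm{SL}_2(\mathbf{Z})$, and let $\Gamma^0(N)$ be the group of all $\gamma\in \mathrm{SL}_2(\mathbf{Z})$ with $\gamma\equiv\left(\begin{smallmatrix} * & 0\\ * & *\end{smallmatrix}\right) \bmod N$, which contains the principal congruence group $\Gamma(N)$. For an even integer $k\ge 4$ and $(a,b)\in (N^{-1}\mathbf{Z}/\mathbf{Z})^2$ put $$E_k^{(a,b)}(z)=\sum_{(0,0)\ne (m,n)\in\mathbf{Z}^2}\frac{\mathrm{e}(an-bm)}{(mz+n)^k}\quad (\mathrm{Im}(z)>0),\qquad E^{a,b}_{k,\Gamma^0(N)}=\sum_{g\in\Gamma(N)\backslash\Gamma^0(N)}E_k^{(a,b)g},$$ where $(a,b)g$ is the product of a row vector and a matrix. Let $$\overline Z_k = \{ z\in\overline{\mathcal F} : E^{a,0}_{k,\Gamma^0(N)}(z)=0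 \text{ for some } a\in N^{-1}\mathbf{Z}/\mathbf{Z}\}.$$ Then, as $k\to+\infty$ through the even integers, the sets $\overline Z_k$ converge in the Hausdorff distance of $\mathbf{C}$ to a closed non-empty set $\overline Z_\infty\subset\mathbf{C}$. For every real number $d\ge 1$, the set $\overline Z_\infty$ contains the whole arc $C_d=\{z\in\overline{\mathcal F} : |z|=d\}$ if and only if $d$ is an integer that divides $N/\mathrm{rad}(N)$, where $\mathrm{rad}(N)$ is the product of the distinct primes dividing $N$. -/

import Mathlib

open Filter Topology Matrix

namespace EisZeros

/-- The group `Γ⁰(N)` of all matrices in `SL₂(ℤ)` that are congruent to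
`(* 0; * *)` modulo `N`. -/
def GammaUpper0 (N : ℕ) : Subgroup (Matrix.SpecialLinearGroup (Fin 2) ℤ) where
  carrier := {g | ((g 0 1 : ℤ) : ZMod N) = 0}
  one_mem' := by simp
  mul_mem' := by
    intro g h hg hh
    simp only [Set.mem_ofPred_eq] at hg hh ⊢
    simp [Matrix.mul_apply, Fin.sum_univ_two, hg, hh]
  inv_mem' := by
    intro g hg
    simp only [Set.mem_ofPred_eq] at hg ⊢
    simp [Matrix.SpecialLinearGroup.SL2_inv_expl, hg]

/-- The Eisenstein series `E_k^{a,b}(z) = ∑_{(m,n) ≠ (0,0)} e(an - bm) / (mz + n)^k`, where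
`(a, b) = (v 0 / N, v 1 / N)` is an element of `(N⁻¹ℤ/ℤ)²`, written through its numerators
`v ∈ (ℤ/Nℤ)²`. The standard additive character of `ℤ/Nℤ` sends the class of `j` to
`e(j / N) = exp(2πij/N)`. -/
noncomputable def eis (N : ℕ) [NeZero N] (k : ℕ) (v : Fin 2 → ZMod N) (z : ℂ) : ℂ :=
  ∑' p : {p : ℤ × ℤ // p ≠ (0, 0)},
    ZMod.stdAddChar (v 0 * (p.1.2 : ZMod N) - v 1 * (p.1.1 : ZMod N)) /
      ((p.1.1 : ℂ) * z + (p.1.2 : ℂ)) ^ k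

/-- The image of a subgroup `Γ` of `SL₂(ℤ)` in `SL₂(ℤ/Nℤ)`. If `Γ(N) ≤ Γ`, this is
`Γ(N) \ Γ`, because `Γ(N)` is the kernel of the reduction map. -/
def reduction (N : ℕ) (Γ : Subgroup (Matrix.SpecialLinearGroup (Fin 2) ℤ)) :
    Subgroup (Matrix.SpecialLinearGroup (Fin 2) (ZMod N)) :=
  Γ.map (Matrix.SpecialLinearGroup.map (Int.castRingHom (ZMod N)))

open Classical in
/-- The trace form `E_{k,Γ}^{(a,b)} = ∑_{g ∈ Γ(N) \ Γ} E_k^{(a,b)g}` of a congruence group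
`Γ ≥ Γ(N)`, where `SL₂(ℤ/Nℤ)` acts on row vectors from the right. -/
noncomputable def eisTrace (N : ℕ) [NeZero N]
    (Γ : Subgroup (Matrix.SpecialLinearGroup (Fin 2) ℤ)) (k : ℕ) (v : Fin 2 → ZMod N)
    (z : ℂ) : ℂ :=
  ∑ g : reduction N Γ,
    eis N k (v ᵥ* (g.1 : Matrix (Fin 2) (Fin 2) (ZMod N))) z

/-- The closure of the standard fundamental domain of `SL₂(ℤ)` in the upper half plane. -/
def closedFundDomain : Set ℂ := {z | 0 < z.im ∧ 1 ≤ ‖z‖ ∧ |z.re| ≤ 1 / 2}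

/-- The set of the zeros in the closed fundamental domain of the series `E_{k,Γ⁰(N)}^{a,0}`, for
all `a = A / N ∈ N⁻¹ℤ/ℤ` together. -/
def zeroSet (N : ℕ) [NeZero N] (k : ℕ) : Set ℂ :=
  {z | z ∈ closedFundDomain ∧ ∃ A : ZMod N, eisTrace N (GammaUpper0 N) k ![A, 0] z = 0}

/-- The arc `C_d` of the circle of radius `d` around `0` in the closed fundamental domain. -/
def arc (d : ℝ) : Set ℂ := {z | z ∈ closedFundDomain ∧ ‖z‖ = d}

/-- The closed non-empty set `L` is the limit in Hausdorff distance of the sets `X k`, as `k`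
tends to infinity through the even integers. The extended Hausdorff distance is used, so a set `X k` that is empty
is at distance `⊤` from `L`. -/
def IsHausdorffLimitEven (X : ℕ → Set ℂ) (L : Set ℂ) : Prop :=
  IsClosed L ∧ L.Nonempty ∧
    Tendsto (fun k => Metric.hausdorffEDist (X k) L) (atTop ⊓ 𝓟 {k : ℕ | Even k}) (𝓝 0)

end EisZeros

/-! Elements of `Γ⁰(N)` are lower triangular mod `N`, so the trace of `E_k^{(a,0)}` is a lattice sum
`∑ c(n) / (mz + n)^k` whose weight `c(n)` is, up to a factor, a normalised Ramanujan sum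
`μ(t)/φ(t)`, with `t` the order of `An` in `ℤ/N`. If `A` has order `q`, this is nonzero exactly when
`D = q / rad q` divides `n` (`isLatticeWeight_traceCoeff`).

For large `k` only the shortest vectors matter: `±z`, of length `|z|`, and `±D`. If `|z|` stays away
from `D`, one pair dominates and there is no zero (`eventually_latticeSum_ne_zero`). On the circle
`|z| = D` the pairs balance: with `z = D exp(w + ζ/k)` and suitable `w`, the sum is, up to a nonzero
factor, close to `1 - exp ζ`, so zeros appear near every interior point of the arc
(`eventually_exists_zero_near`).

As `A` varies, `D` runs over all divisors of `N / rad N`, so the limit is the union of these arcs.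
-/

namespace EisZeros

/-! ### Ramanujan sums over units. -/

/-- The sum of the primitive `n`-th roots of unity is `μ(n)`. -/
theorem sum_primitiveRoots_eq_moebius {n : ℕ} (hn : 0 < n) :
    ∑ ζ ∈ primitiveRoots n ℂ, ζ = (ArithmeticFunction.moebius n : ℂ) := by
  have key : ∀ n > 0, ∑ i ∈ n.divisors, (∑ ζ ∈ primitiveRoots i ℂ, ζ) =
      if n = 1 then (1 : ℂ) else 0 := by
    intro n hn
    have hd : ((n.divisors : Finset ℕ) : Set ℕ).PairwiseDisjoint fun i => primitiveRoots i ℂ :=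
      fun i _ j _ hij => IsPrimitiveRoot.disjoint hij
    rw [← Finset.sum_biUnion hd, ← IsPrimitiveRoot.nthRoots_one_eq_biUnion_primitiveRoots]
    obtain ⟨ζ, hζ⟩ : ∃ ζ : ℂ, IsPrimitiveRoot ζ n :=
      ⟨_, Complex.isPrimitiveRoot_exp n hn.ne'⟩
    have himg : Polynomial.nthRootsFinset n (1 : ℂ) = (Finset.range n).image (ζ ^ ·) := by
      ext x
      rw [Polynomial.mem_nthRootsFinset hn, Finset.mem_image]
      constructor
      · intro hx
        have : NeZero n := ⟨hn.ne'⟩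
        obtain ⟨i, hi, h⟩ := hζ.eq_pow_of_pow_eq_one hx
        exact ⟨i, Finset.mem_range.2 hi, h⟩
      · rintro ⟨i, -, rfl⟩
        rw [← pow_mul, mul_comm, pow_mul, hζ.pow_eq_one, one_pow]
    rw [himg, Finset.sum_image (fun i hi j hj h => hζ.pow_inj (by simpa using hi)
      (by simpa using hj) h)]
    split_ifs with h1
    · subst h1; simp
    · exact hζ.geom_sum_eq_zero (by omega)
  -- Möbius inversion; only the pair `(n, 1)` contributes.
  have := (ArithmeticFunction.sum_eq_iff_sum_mul_moebius_eq (R := ℂ)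
    (f := fun i => ∑ ζ ∈ primitiveRoots i ℂ, ζ) (g := fun n => if n = 1 then (1 : ℂ) else 0)).1
    key n hn
  rw [← this, Finset.sum_eq_single (n, 1)]
  · simp
  · rintro ⟨a, b⟩ hab hne
    rw [Nat.mem_divisorsAntidiagonal] at hab
    have : b ≠ 1 := by
      rintro rfl
      apply hne
      simp at hab
      simp [hab.1]
    simp [this]
  · intro h
    exact absurd (by simp [hn.ne']) h

theorem sum_units_pow_eq_moebius {t : ℕ} [NeZero t] {ζ : ℂ} (hζ : IsPrimitiveRoot ζ t) :
    ∑ w : (ZMod t)ˣ, ζ ^ (w : ZMod t).val = (ArithmeticFunction.moebius t : ℂ) := by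
  rw [← sum_primitiveRoots_eq_moebius (NeZero.pos t)]
  refine Finset.sum_bij (fun w _ => ζ ^ (w : ZMod t).val) ?_ ?_ ?_ (fun _ _ => rfl)
  · intro w _
    rw [mem_primitiveRoots (NeZero.pos t)]
    exact hζ.pow_of_coprime _ (ZMod.val_coe_unit_coprime w)
  · intro w _ w' _ h
    exact Units.ext (ZMod.val_injective t (hζ.pow_inj (ZMod.val_lt _) (ZMod.val_lt _) h))
  · intro ξ hξ
    rw [mem_primitiveRoots (NeZero.pos t)] at hξ
    obtain ⟨i, hi, hc, h⟩ := hζ.isPrimitiveRoot_iff.1 hξ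
    refine ⟨ZMod.unitOfCoprime i hc, Finset.mem_univ _, ?_⟩
    rw [ZMod.coe_unitOfCoprime, ZMod.val_natCast_of_lt hi, h]

theorem sum_comp_of_surjective {G H : Type*} [Group G] [Group H] [Fintype G] [Fintype H]
    [DecidableEq H] (f : G →* H) (hf : Function.Surjective f) (F : H → ℂ) :
    ∑ g, F (f g) = (Fintype.card G / Fintype.card H : ℂ) * ∑ h, F h := by
  have hcard : ∀ h, (Finset.univ.filter fun g => f g = h).card =
      (Finset.univ.filter fun g => f g = 1).card := fun h =>
    MonoidHom.card_fiber_eq_of_mem_range f (hf h) (hf 1)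
  have hG : Fintype.card G =
      Fintype.card H * (Finset.univ.filter fun g => f g = 1).card := by
    rw [← Finset.card_univ, Finset.card_eq_sum_card_fiberwise (f := f) (t := Finset.univ)
      (fun _ _ => Finset.mem_coe.2 (Finset.mem_univ _)), Finset.sum_congr rfl fun h _ => hcard h]
    simp
  have hH : (Fintype.card H : ℂ) ≠ 0 := by exact_mod_cast Fintype.card_ne_zero
  rw [← Finset.sum_fiberwise (s := Finset.univ) (g := f), Finset.mul_sum]
  refine Finset.sum_congr rfl fun h _ => ?_
  rw [Finset.sum_congr rfl (g := fun _ => F h) (by simp +contextual), Finset.sum_const, hcard h,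
    nsmul_eq_mul, hG]
  push_cast
  field_simp

/-! ### The image of `Γ⁰(N)` modulo `N`. -/

section reduction

variable (N : ℕ)

theorem reduction_zero_one {N : ℕ} (g : reduction N (GammaUpper0 N)) : g.1 0 1 = 0 := by
  obtain ⟨_, γ, hγ, rfl⟩ := g
  have h : ((γ 0 1 : ℤ) : ZMod N) = 0 := hγ
  simpa using h

theorem reduction_mul_eq_one {N : ℕ} (g : reduction N (GammaUpper0 N)) :
    g.1 0 0 * g.1 1 1 = 1 := by
  have := g.1.det_coe
  rw [Matrix.det_fin_two, reduction_zero_one g] at this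
  simpa using this

/-- The upper left entry of an element of `Γ⁰(N) / Γ(N)`. -/
def diagUnit : reduction N (GammaUpper0 N) →* (ZMod N)ˣ where
  toFun g := Units.mkOfMulEqOne (g.1 0 0) (g.1 1 1) (reduction_mul_eq_one g)
  map_one' := by ext; simp
  map_mul' g h := by
    ext
    simp [Matrix.mul_apply, Fin.sum_univ_two, reduction_zero_one]

@[simp] theorem coe_diagUnit (g : reduction N (GammaUpper0 N)) :
    (diagUnit N g : ZMod N) = g.1 0 0 := rfl

theorem diagUnit_surjective : Function.Surjective (diagUnit N) := by
  intro u
  obtain ⟨a, ha⟩ := ZMod.intCast_surjective (u : ZMod N)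
  obtain ⟨d, hd⟩ := ZMod.intCast_surjective ((u⁻¹ : (ZMod N)ˣ) : ZMod N)
  have h1 : ((a * d - 1 : ℤ) : ZMod N) = 0 := by push_cast; rw [ha, hd]; simp
  obtain ⟨b, hb⟩ := (ZMod.intCast_zmod_eq_zero_iff_dvd _ N).1 h1
  -- Here `a * d = 1 + N * b`, so the determinant is one.
  let γ : Matrix.SpecialLinearGroup (Fin 2) ℤ :=
    ⟨!![a, N * b; 1, d], by rw [Matrix.det_fin_two_of, ← hb]; ring⟩
  refine ⟨⟨_, γ, ?_, rfl⟩, ?_⟩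
  · show ((γ 0 1 : ℤ) : ZMod N) = 0
    simp [γ]
  · ext
    show ((γ 0 0 : ℤ) : ZMod N) = u
    simp [γ, ha]

end reduction

/-! ### The trace coefficients and their support. -/

open Classical in
/-- The coefficient of `(mz + n)^(-k)` in the trace of `E_k^{(A/N,0)}` to `Γ⁰(N)`. -/
noncomputable def traceCoeff (N : ℕ) [NeZero N] (A : ZMod N) (n : ℤ) : ℂ :=
  ∑ g : reduction N (GammaUpper0 N), ZMod.stdAddChar (A * g.1 0 0 * (n : ZMod N))

theorem isPrimitiveRoot_stdAddChar {N : ℕ} [NeZero N] (x : ZMod N) :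
    IsPrimitiveRoot (ZMod.stdAddChar x : ℂ) (addOrderOf x) := by
  constructor
  · rw [← AddChar.map_nsmul_eq_pow, addOrderOf_nsmul_eq_zero, AddChar.map_zero_eq_one]
  · intro l hl
    rw [← AddChar.map_nsmul_eq_pow, ← AddChar.map_zero_eq_one (ZMod.stdAddChar (N := N))] at hl
    exact addOrderOf_dvd_iff_nsmul_eq_zero.2 (ZMod.injective_stdAddChar hl)

theorem addOrderOf_zmod_dvd {N : ℕ} [NeZero N] (x : ZMod N) : addOrderOf x ∣ N :=
  addOrderOf_dvd_iff_nsmul_eq_zero.2 (by simp)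

open Classical in
theorem traceCoeff_eq (N : ℕ) [NeZero N] (A : ZMod N) (n : ℤ) :
    traceCoeff N A n = (Fintype.card (reduction N (GammaUpper0 N)) : ℂ) /
      (Nat.totient (addOrderOf (A * (n : ZMod N))) : ℂ) *
        (ArithmeticFunction.moebius (addOrderOf (A * (n : ZMod N))) : ℂ) := by
  set x : ZMod N := A * (n : ZMod N) with hx
  set t := addOrderOf x with ht
  have htN : t ∣ N := addOrderOf_zmod_dvd x
  have : NeZero t := ⟨(addOrderOf_pos x).ne'⟩
  have hζ := isPrimitiveRoot_stdAddChar x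
  -- The character value at `x` is a primitive `t`-th root of unity, so each summand depends only on
  -- the diagonal unit modulo `t`, and the sum descends to `(ZMod t)ˣ`.
  have hsurj : Function.Surjective ((ZMod.unitsMap htN).comp (diagUnit N)) :=
    (ZMod.unitsMap_surjective htN).comp (diagUnit_surjective N)
  have := sum_comp_of_surjective _ hsurj
    fun w => (ZMod.stdAddChar x : ℂ) ^ (w : ZMod t).val
  rw [sum_units_pow_eq_moebius hζ, ZMod.card_units_eq_totient] at this
  rw [← this, traceCoeff]
  refine Finset.sum_congr rfl fun g _ => ?_
  have h1 : A * g.1 0 0 * (n : ZMod N) = (g.1 0 0).val • x := by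
    rw [nsmul_eq_mul, ZMod.natCast_zmod_val, hx]; ring
  have h2 : ((ZMod.unitsMap htN (diagUnit N g) : (ZMod t)ˣ) : ZMod t) =
      (((g.1 0 0).val : ℕ) : ZMod t) := by
    rw [ZMod.unitsMap_val, coe_diagUnit, ZMod.cast_eq_val]
  rw [h1, AddChar.map_nsmul_eq_pow, MonoidHom.comp_apply, h2, ZMod.val_natCast, ht,
    hζ.eq_orderOf]
  exact (pow_mod_orderOf _ _).symm

/-- The properties of the coefficients of a lattice sum `∑ c(n) / (mz + n)^k` that determine
where its zeros accumulate. -/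
structure IsLatticeWeight (D : ℕ) (c : ℤ → ℂ) : Prop where
  norm_le : ∀ n, ‖c n‖ ≤ ‖c 0‖
  even : ∀ n, c (-n) = c n
  ne_zero_iff : ∀ n, c n ≠ 0 ↔ (D : ℤ) ∣ n

-- A divisor of `q` is squarefree iff it divides `radical q`; passing to complementary divisors
-- turns this into `q / radical q ∣ q.gcd n`.
open UniqueFactorizationMonoid in
theorem squarefree_div_gcd_iff {q n : ℕ} (hq : q ≠ 0) :
    Squarefree (q / q.gcd n) ↔ q / radical q ∣ n := by
  have hg : q.gcd n ∣ q := Nat.gcd_dvd_left q n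
  have hr : radical q ∣ q := radical_dvd_self
  constructor
  · intro h
    have h1 : q / q.gcd n ∣ radical q :=
      (dvd_radical_iff h.isRadical hq).2 (Nat.div_dvd_of_dvd hg)
    have h2 : q / radical q ∣ q.gcd n := by
      obtain ⟨s, hs⟩ := hg
      have hg0 : 0 < q.gcd n := Nat.gcd_pos_of_pos_left n (Nat.pos_of_ne_zero hq)
      rw [Nat.div_eq_of_eq_mul_right hg0 hs] at h1
      rw [Nat.div_dvd_iff_dvd_mul hr (Nat.radical_pos q)]
      nth_rw 1 [hs]
      rw [mul_comm]
      exact mul_dvd_mul_right h1 _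
    exact h2.trans (Nat.gcd_dvd_right q n)
  · intro h
    have h1 : q / radical q ∣ q.gcd n := Nat.dvd_gcd (Nat.div_dvd_of_dvd hr) h
    refine Squarefree.squarefree_of_dvd ?_ (squarefree_radical (a := q))
    have hg0 : 0 < q.gcd n := Nat.gcd_pos_of_pos_left n (Nat.pos_of_ne_zero hq)
    rw [Nat.div_dvd_iff_dvd_mul hg hg0]
    rw [Nat.div_dvd_iff_dvd_mul hr (Nat.radical_pos q)] at h1
    rwa [mul_comm]

open UniqueFactorizationMonoid in
theorem div_radical_dvd_div_radical {q N : ℕ} (hN : N ≠ 0) (h : q ∣ N) :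
    q / radical q ∣ N / radical N := by
  obtain ⟨r, rfl⟩ := h
  have hr : r ≠ 0 := right_ne_zero_of_mul hN
  rw [Nat.dvd_div_iff_mul_dvd radical_dvd_self]
  have h1 : radical (q * r) ∣ radical q * r :=
    radical_mul_dvd.trans (mul_dvd_mul_left _ radical_dvd_self)
  calc radical (q * r) * (q / radical q) ∣ radical q * r * (q / radical q) :=
        mul_dvd_mul_right h1 _
    _ = q * r := by
        rw [mul_right_comm, Nat.mul_div_cancel' radical_dvd_self]

-- An element of order `D * radical D` works. This order divides `N` because `radical N * D` does,
-- and it has the same radical as `D`.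
open UniqueFactorizationMonoid in
theorem exists_addOrderOf_div_radical {N D : ℕ} [NeZero N] (hD : D ∣ N / radical N) :
    ∃ A : ZMod N, addOrderOf A / radical (addOrderOf A) = D := by
  have hN : N ≠ 0 := NeZero.ne N
  have hD0 : D ≠ 0 := by
    rintro rfl
    have := Nat.div_pos (Nat.radical_le_self_iff.2 hN) (Nat.radical_pos N)
    rw [zero_dvd_iff] at hD
    omega
  have h1 : radical N * D ∣ N := (Nat.dvd_div_iff_mul_dvd radical_dvd_self).1 hD
  have h2 : D * radical D ∣ N := by
    refine dvd_trans ?_ h1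
    rw [mul_comm]
    exact mul_dvd_mul_right (radical_dvd_radical ((dvd_mul_left D _).trans h1) hN) _
  have hrad : radical (D * radical D) = radical D := by
    apply Nat.dvd_antisymm
    · refine (dvd_radical_iff squarefree_radical.isRadical hD0).2 ?_
      have : radical (D * radical D) ∣ radical (D ^ 2) :=
        radical_dvd_radical (by rw [sq]; exact mul_dvd_mul_left _ radical_dvd_self)
          (pow_ne_zero _ hD0)
      rw [radical_pow _ two_ne_zero] at this
      exact this.trans radical_dvd_self
    · exact radical_dvd_radical (dvd_mul_right _ _) (mul_ne_zero hD0 radical_ne_zero)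
  obtain ⟨r, hr⟩ := h2
  have hr0 : 0 < r := Nat.pos_of_ne_zero (by rintro rfl; simp at hr; exact hN hr)
  have hord : addOrderOf ((r : ℕ) : ZMod N) = D * radical D := by
    rw [ZMod.addOrderOf_coe _ hN, Nat.gcd_eq_right (Dvd.intro_left _ hr.symm)]
    exact Nat.div_eq_of_eq_mul_left hr0 hr
  refine ⟨(r : ℕ), ?_⟩
  rw [hord, hrad, Nat.mul_div_cancel _ (Nat.radical_pos D)]

open Classical in
theorem traceCoeff_zero (N : ℕ) [NeZero N] (A : ZMod N) :
    traceCoeff N A 0 = (Fintype.card (reduction N (GammaUpper0 N)) : ℂ) := by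
  simp [traceCoeff]

theorem addOrderOf_mul_intCast {N : ℕ} [NeZero N] (A : ZMod N) (n : ℤ) :
    addOrderOf (A * (n : ZMod N)) = addOrderOf A / (addOrderOf A).gcd n.natAbs := by
  rw [← addOrderOf_nsmul, nsmul_eq_mul]
  rcases Int.natAbs_eq n with h | h
  · conv_lhs => rw [h]
    rw [Int.cast_natCast, mul_comm]
  · conv_lhs => rw [h]
    rw [Int.cast_neg, Int.cast_natCast, mul_neg, addOrderOf_neg, mul_comm]

open UniqueFactorizationMonoid in
theorem isLatticeWeight_traceCoeff (N : ℕ) [NeZero N] (A : ZMod N) :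
    IsLatticeWeight (addOrderOf A / radical (addOrderOf A)) (traceCoeff N A) where
  norm_le n := by
    classical
    rw [traceCoeff_zero, traceCoeff]
    refine (norm_sum_le _ _).trans ?_
    rw [Finset.sum_congr rfl (g := fun _ => (1 : ℝ)) fun g _ => by
      rw [ZMod.stdAddChar_apply]; exact Circle.norm_coe _]
    simp
  even n := by
    rw [traceCoeff_eq, traceCoeff_eq, addOrderOf_mul_intCast, addOrderOf_mul_intCast,
      Int.natAbs_neg]
  ne_zero_iff n := by
    classical
    have hq : addOrderOf A ≠ 0 := (addOrderOf_pos A).ne'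
    rw [traceCoeff_eq, Int.natCast_dvd,
      ← squarefree_div_gcd_iff hq, ← addOrderOf_mul_intCast,
      ← ArithmeticFunction.moebius_ne_zero_iff_squarefree]
    have h1 : (Nat.totient (addOrderOf (A * (n : ZMod N))) : ℂ) ≠ 0 := by
      exact_mod_cast (Nat.totient_pos.2 (addOrderOf_pos _)).ne'
    have h2 : (Fintype.card (reduction N (GammaUpper0 N)) : ℂ) ≠ 0 := by
      exact_mod_cast Fintype.card_ne_zero
    simp [h1, h2]

theorem traceCoeff_zero_left (N : ℕ) [NeZero N] (n : ℤ) :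
    traceCoeff N 0 n = traceCoeff N 0 0 := by
  simp [traceCoeff]

/-! ### Lattice sums and uniform tail bounds. -/

/-- The term of index `(m, n)` of the lattice sum `∑ c(n) / (mz + n)^k`. -/
noncomputable def latticeTerm (c : ℤ → ℂ) (k : ℕ) (z : ℂ) (p : ℤ × ℤ) : ℂ :=
  c p.2 / ((p.1 : ℂ) * z + (p.2 : ℂ)) ^ k

/-- The lattice sum `∑ c(n) / (mz + n)^k`; the term of index `(0, 0)` is zero if `k ≠ 0`. -/
noncomputable def latticeSum (c : ℤ → ℂ) (k : ℕ) (z : ℂ) : ℂ :=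
  ∑' p : ℤ × ℤ, latticeTerm c k z p

/-- A neighbourhood of the interior of the closed fundamental domain on which lattice vectors
`mz + n` are uniformly long. -/
def wideDomain : Set ℂ := {z | |z.re| ≤ 1 / 2 ∧ 1 / 2 ≤ ‖z‖ ^ 2}

theorem closedFundDomain_subset_wideDomain : closedFundDomain ⊆ wideDomain := by
  rintro z ⟨-, h1, h2⟩
  exact ⟨h2, by nlinarith⟩

theorem norm_sq_eq (z : ℂ) : ‖z‖ ^ 2 = z.re ^ 2 + z.im ^ 2 := by
  rw [Complex.sq_norm, Complex.normSq_apply]; ring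

theorem norm_sq_lattice (z : ℂ) (m n : ℤ) :
    ‖(m : ℂ) * z + n‖ ^ 2 = (m : ℝ) ^ 2 * ‖z‖ ^ 2 + 2 * m * n * z.re + (n : ℝ) ^ 2 := by
  rw [norm_sq_eq, norm_sq_eq]
  simp
  ring

theorem abs_mul_re_le {z : ℂ} {b : ℝ} (h : |z.re| ≤ b) (m n : ℝ) :
    -(2 * b * (|m| * |n|)) ≤ 2 * m * n * z.re := by
  have h1 : |m * n * z.re| ≤ |m| * |n| * b := by
    rw [abs_mul, abs_mul]
    exact mul_le_mul_of_nonneg_left h (by positivity)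
  have := (abs_le.1 h1).1
  linarith

/-- On `wideDomain` the norm form is at least `m²/2 - |mn| + n²`, whose least eigenvalue exceeds
`1/10`. -/
theorem sq_add_sq_le_norm_sq {z : ℂ} (hz : z ∈ wideDomain) (m n : ℤ) :
    ((m : ℝ) ^ 2 + (n : ℝ) ^ 2) / 10 ≤ ‖(m : ℂ) * z + n‖ ^ 2 := by
  rw [norm_sq_lattice]
  have h1 := abs_mul_re_le hz.1 m n
  have h2 : (m : ℝ) ^ 2 * (1 / 2) ≤ (m : ℝ) ^ 2 * ‖z‖ ^ 2 :=
    mul_le_mul_of_nonneg_left hz.2 (sq_nonneg _)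
  rw [← sq_abs (m : ℝ), ← sq_abs (n : ℝ)] at *
  nlinarith [sq_nonneg (3 * |(m : ℝ)| - 4 * |(n : ℝ)|)]

theorem one_le_sq_add_sq {p : ℤ × ℤ} (hp : p ≠ 0) : (1 : ℝ) ≤ (p.1 : ℝ) ^ 2 + (p.2 : ℝ) ^ 2 := by
  have : (1 : ℤ) ≤ p.1 ^ 2 + p.2 ^ 2 := by
    by_contra! h
    apply hp
    have h1 : p.1 = 0 := by nlinarith [sq_nonneg p.1, sq_nonneg p.2]
    have h2 : p.2 = 0 := by nlinarith [sq_nonneg p.1, sq_nonneg p.2]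
    exact Prod.ext h1 h2
  exact_mod_cast this

theorem quarter_le_norm {z : ℂ} (hz : z ∈ wideDomain) {p : ℤ × ℤ} (hp : p ≠ 0) :
    1 / 4 ≤ ‖(p.1 : ℂ) * z + p.2‖ := by
  have h1 := sq_add_sq_le_norm_sq hz p.1 p.2
  have h2 := one_le_sq_add_sq hp
  refine le_of_sq_le_sq ?_ (norm_nonneg _)
  nlinarith

theorem summable_inv_sq_add_sq :
    Summable fun p : ℤ × ℤ => (((p.1 : ℝ) ^ 2 + (p.2 : ℝ) ^ 2) ^ 2)⁻¹ := by
  have h := (EisensteinSeries.summable_one_div_norm_rpow (k := 4) (by norm_num))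
  rw [← (finTwoArrowEquiv ℤ).symm.summable_iff] at h
  refine Summable.of_nonneg_of_le (fun p => by positivity) (fun p => ?_) h
  by_cases hp : p = 0
  · subst hp
    simp only [Prod.fst_zero, Prod.snd_zero]
    norm_num
  have hv : (finTwoArrowEquiv ℤ).symm p ≠ 0 := by
    intro h0
    apply hp
    have a0 := congrFun h0 0
    have a1 := congrFun h0 1
    simp at a0 a1
    exact Prod.ext a0 a1
  have hpos : 0 < ‖(finTwoArrowEquiv ℤ).symm p‖ := norm_pos_iff.2 hv
  rw [Function.comp_apply, Real.rpow_neg hpos.le]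
  have h4 : ‖(finTwoArrowEquiv ℤ).symm p‖ ^ (4 : ℝ) = (‖(finTwoArrowEquiv ℤ).symm p‖ ^ 2) ^ 2 := by
    rw [← pow_mul, ← Real.rpow_natCast]; norm_num
  rw [h4]
  have hle : ‖(finTwoArrowEquiv ℤ).symm p‖ ^ 2 ≤ (p.1 : ℝ) ^ 2 + (p.2 : ℝ) ^ 2 := by
    have : ‖(finTwoArrowEquiv ℤ).symm p‖ ≤ √((p.1 : ℝ) ^ 2 + (p.2 : ℝ) ^ 2) := by
      rw [pi_norm_le_iff_of_nonneg (Real.sqrt_nonneg _)]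
      intro i
      apply Real.le_sqrt_of_sq_le
      fin_cases i
      · simp [sq_nonneg, Int.norm_eq_abs]
      · simp [sq_nonneg, Int.norm_eq_abs]
    calc _ ≤ √((p.1 : ℝ) ^ 2 + (p.2 : ℝ) ^ 2) ^ 2 := by gcongr
      _ = _ := Real.sq_sqrt (by positivity)
  gcongr

/-- A constant for bounds of tails of lattice sums. -/
noncomputable def tailConst : ℝ :=
  ∑' p : ℤ × ℤ, 100 * (((p.1 : ℝ) ^ 2 + (p.2 : ℝ) ^ 2) ^ 2)⁻¹

theorem tailConst_nonneg : 0 ≤ tailConst := tsum_nonneg fun p => by positivity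

variable {D k : ℕ} {c : ℤ → ℂ} {z : ℂ}

theorem IsLatticeWeight.zero_ne_zero (hc : IsLatticeWeight D c) : c 0 ≠ 0 :=
  (hc.ne_zero_iff 0).2 (dvd_zero _)

theorem IsLatticeWeight.self_ne_zero (hc : IsLatticeWeight D c) : c D ≠ 0 :=
  (hc.ne_zero_iff D).2 dvd_rfl

/-- Four of the `k` factors provide summability uniformly in `z`; the other `k - 4` are each at
least `R`. Tails thus decay like `R ^ (-k)` with a constant independent of `k` and `z`. -/
theorem norm_latticeTerm_le (hc : IsLatticeWeight D c) (hz : z ∈ wideDomain) (hk : 4 ≤ k)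
    {R : ℝ} (hR : 0 < R) {p : ℤ × ℤ} (hp : p ≠ 0) (h : R ≤ ‖(p.1 : ℂ) * z + p.2‖) :
    ‖latticeTerm c k z p‖ ≤
      100 * (((p.1 : ℝ) ^ 2 + (p.2 : ℝ) ^ 2) ^ 2)⁻¹ * (‖c 0‖ * R ^ 4 / R ^ k) := by
  obtain ⟨j, rfl⟩ := Nat.exists_eq_add_of_le hk
  have h1 := sq_add_sq_le_norm_sq hz p.1 p.2
  have h2 := one_le_sq_add_sq hp
  set S := (p.1 : ℝ) ^ 2 + (p.2 : ℝ) ^ 2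
  have h3 : (S ^ 2 / 100) * R ^ j ≤ ‖(p.1 : ℂ) * z + p.2‖ ^ (4 + j) := by
    rw [pow_add]
    refine mul_le_mul ?_ (pow_le_pow_left₀ hR.le h _) (by positivity) (by positivity)
    calc S ^ 2 / 100 = (S / 10) ^ 2 := by ring
      _ ≤ (‖(p.1 : ℂ) * z + p.2‖ ^ 2) ^ 2 := by gcongr
      _ = _ := by ring
  rw [latticeTerm, norm_div, norm_pow]
  calc _ ≤ ‖c 0‖ / ((S ^ 2 / 100) * R ^ j) :=
        div_le_div₀ (norm_nonneg _) (hc.norm_le _) (by positivity) h3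
    _ = _ := by
        rw [pow_add]
        field_simp

theorem latticeTerm_zero (hk : 4 ≤ k) : latticeTerm c k z 0 = 0 := by
  have : k ≠ 0 := by omega
  simp [latticeTerm, this]

theorem norm_latticeTerm_le_of_mem (hc : IsLatticeWeight D c) (hz : z ∈ wideDomain) (hk : 4 ≤ k)
    (p : ℤ × ℤ) : ‖latticeTerm c k z p‖ ≤
      100 * (((p.1 : ℝ) ^ 2 + (p.2 : ℝ) ^ 2) ^ 2)⁻¹ *
        (‖c 0‖ * (1 / 4) ^ 4 / (1 / 4) ^ k) := by
  by_cases hp : p = 0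
  · subst hp
    rw [latticeTerm_zero hk, norm_zero]
    positivity
  · exact norm_latticeTerm_le hc hz hk (by norm_num) hp (quarter_le_norm hz hp)

theorem summable_latticeTerm (hc : IsLatticeWeight D c) (hz : z ∈ wideDomain) (hk : 4 ≤ k) :
    Summable (latticeTerm c k z) :=
  Summable.of_norm_bounded ((summable_inv_sq_add_sq.mul_left 100).mul_right _)
    (norm_latticeTerm_le_of_mem hc hz hk)

theorem norm_latticeSum_sub_le (hc : IsLatticeWeight D c) (hz : z ∈ wideDomain) (hk : 4 ≤ k)
    {R : ℝ} (hR : 0 < R) (s : Finset (ℤ × ℤ))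
    (h : ∀ p ∉ s, p ≠ 0 → (D : ℤ) ∣ p.2 → R ≤ ‖(p.1 : ℂ) * z + p.2‖) :
    ‖latticeSum c k z - ∑ p ∈ s, latticeTerm c k z p‖ ≤
      tailConst * (‖c 0‖ * R ^ 4 / R ^ k) := by
  have hs : HasSum (fun p => if p ∈ s then latticeTerm c k z p else 0)
      (∑ p ∈ s, latticeTerm c k z p) := by
    have : HasSum (fun p => if p ∈ s then latticeTerm c k z p else 0)
        (∑ p ∈ s, if p ∈ s then latticeTerm c k z p else 0) :=
      hasSum_sum_of_ne_finset_zero (fun p hp => by simp [hp])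
    rwa [Finset.sum_congr rfl fun p hp => if_pos hp] at this
  rw [latticeSum, ← hs.tsum_eq, ← (summable_latticeTerm hc hz hk).tsum_sub hs.summable]
  refine tsum_of_norm_bounded
    (((summable_inv_sq_add_sq.mul_left 100).hasSum).mul_right (‖c 0‖ * R ^ 4 / R ^ k)) ?_
  intro p
  split_ifs with hps
  · rw [sub_self, norm_zero]; positivity
  rw [sub_zero]
  by_cases hp : p = 0
  · subst hp
    rw [latticeTerm_zero hk, norm_zero]
    positivity
  by_cases hd : (D : ℤ) ∣ p.2
  · exact norm_latticeTerm_le hc hz hk hR hp (h p hps hp hd)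
  · have : c p.2 = 0 := by
      by_contra h0
      exact hd ((hc.ne_zero_iff _).1 h0)
    rw [latticeTerm, this, zero_div, norm_zero]
    positivity

theorem differentiableOn_latticeSum (hc : IsLatticeWeight D c) (hk : 4 ≤ k) {V : Set ℂ}
    (hV : IsOpen V) (hVU : V ⊆ wideDomain) : DifferentiableOn ℂ (latticeSum c k) V := by
  refine Complex.differentiableOn_tsum_of_summable_norm
    ((summable_inv_sq_add_sq.mul_left 100).mul_right (‖c 0‖ * (1 / 4) ^ 4 / (1 / 4) ^ k))
    (F := fun p z => latticeTerm c k z p) ?_ hV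
    (fun p w hw => norm_latticeTerm_le_of_mem hc (hVU hw) hk p)
  intro p
  by_cases hp : p = 0
  · subst hp
    simp only [latticeTerm_zero hk]
    exact differentiableOn_const _
  · unfold latticeTerm
    refine DifferentiableOn.div (differentiableOn_const _) (by fun_prop) fun w hw => ?_
    refine pow_ne_zero _ (norm_pos_iff.1 ?_)
    exact lt_of_lt_of_le (by norm_num) (quarter_le_norm (hVU hw) hp)

/-! ### No zeros away from the circle of radius `D`. -/

theorem sum_latticeTerm_horizontal (hc : IsLatticeWeight D c) (hD : D ≠ 0) (hk : Even k) :
    ∑ p ∈ ({(0, (D : ℤ)), (0, -(D : ℤ))} : Finset (ℤ × ℤ)), latticeTerm c k z p =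
      2 * c D / (D : ℂ) ^ k := by
  have : (D : ℤ) ≠ -D := by omega
  rw [Finset.sum_pair (by simpa using this)]
  simp only [latticeTerm, hc.even]
  simp [hk.neg_pow]
  ring

theorem sum_latticeTerm_vertical (hk : Even k) :
    ∑ p ∈ ({(1, 0), (-1, 0)} : Finset (ℤ × ℤ)), latticeTerm c k z p =
      2 * c 0 / z ^ k := by
  rw [Finset.sum_pair (by simp)]
  simp [latticeTerm, hk.neg_pow]
  ring

/-- At a zero the tail would equal the block over `s` in size; multiplying by `ρ ^ k` contradicts
`ha`. Replacing `ρ ^ 4` by `D ^ 4` makes the threshold for `k` independent of `z`. -/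
theorem latticeSum_ne_zero_of_dominant (hc : IsLatticeWeight D c) (hz : z ∈ wideDomain)
    (hk : 4 ≤ k) {ρ l a : ℝ} (hρ : 0 < ρ) (hρD : ρ ≤ D) (hl : 0 < l) (s : Finset (ℤ × ℤ))
    (hs : ‖∑ p ∈ s, latticeTerm c k z p‖ = a / ρ ^ k)
    (h : ∀ p ∉ s, p ≠ 0 → (D : ℤ) ∣ p.2 → l * ρ ≤ ‖(p.1 : ℂ) * z + p.2‖)
    (ha : tailConst * ‖c 0‖ * l ^ 4 * D ^ 4 / l ^ k < a) : latticeSum c k z ≠ 0 := by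
  intro h0
  have h1 := norm_latticeSum_sub_le hc hz hk (mul_pos hl hρ) s h
  rw [h0, zero_sub, norm_neg, hs, div_le_iff₀ (by positivity)] at h1
  refine absurd ha (not_lt.2 (h1.trans ?_))
  have h2 : tailConst * (‖c 0‖ * (l * ρ) ^ 4 / (l * ρ) ^ k) * ρ ^ k =
      tailConst * ‖c 0‖ * l ^ 4 * ρ ^ 4 / l ^ k := by
    rw [mul_pow, mul_pow]; field_simp
  rw [h2]
  have := tailConst_nonneg
  gcongr

theorem eventually_div_pow_lt {l a : ℝ} (C : ℝ) (hl : 1 < l) (ha : 0 < a) :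
    ∀ᶠ k : ℕ in atTop, C / l ^ k < a := by
  have h := (tendsto_pow_atTop_nhds_zero_of_lt_one (by positivity)
    (inv_lt_one_of_one_lt₀ hl)).const_mul C
  rw [mul_zero] at h
  filter_upwards [h.eventually (gt_mem_nhds ha)] with k hk
  rwa [div_eq_mul_inv, ← inv_pow]

/-- Away from the circle of radius `D` one pair of terms of the lattice sum dominates. -/
theorem eventually_latticeSum_ne_zero (hc : IsLatticeWeight D c) (hD : D ≠ 0) {δ : ℝ}
    (hδ : 0 < δ) (hδ1 : δ < 1) :
    ∀ᶠ k : ℕ in atTop, Even k → ∀ z ∈ closedFundDomain, latticeSum c k z = 0 →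
      |‖z‖ - D| < δ := by
  have hD1 : (1 : ℝ) ≤ D := by exact_mod_cast Nat.one_le_iff_ne_zero.2 hD
  -- Factors by which the other vectors exceed the dominant pair, outside and inside the circle.
  -- Inside, `D / (D - δ)` serves the vectors with `m = 0` and `11 / 10` those with `m ≠ 0`.
  set l₁ : ℝ := (D + δ) / D with hl₁
  set l₂ : ℝ := min (D / (D - δ)) (11 / 10) with hl₂
  have hl₁1 : 1 < l₁ := by rw [hl₁, one_lt_div (by positivity)]; linarith
  have hl₂1 : 1 < l₂ := by
    refine lt_min ?_ (by norm_num)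
    rw [one_lt_div (by linarith)]; linarith
  have hc0 := norm_pos_iff.2 hc.zero_ne_zero
  have hcD := norm_pos_iff.2 hc.self_ne_zero
  filter_upwards [eventually_ge_atTop 4,
    eventually_div_pow_lt (tailConst * ‖c 0‖ * l₁ ^ 4 * D ^ 4) hl₁1
      (mul_pos two_pos hcD),
    eventually_div_pow_lt (tailConst * ‖c 0‖ * l₂ ^ 4 * D ^ 4) hl₂1
      (mul_pos two_pos hc0)] with k hk4 hk1 hk2 hk z hz h0
  have hzU := closedFundDomain_subset_wideDomain hz
  obtain ⟨-, hz1, hz2⟩ := hz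
  have hre2 : z.re ^ 2 ≤ 1 / 4 := by
    rw [← sq_abs]; nlinarith [abs_nonneg z.re]
  by_contra! hfar
  rcases le_abs'.1 hfar with hlt | hgt
  · refine latticeSum_ne_zero_of_dominant hc hzU hk4 (ρ := ‖z‖) (by linarith) (by linarith)
      (by linarith) {(1, 0), (-1, 0)} ?_ ?_ hk2 h0
    · rw [sum_latticeTerm_vertical hk]; simp
    have hzD : ‖z‖ ≤ D - δ := by linarith
    -- Since `1 ≤ ‖z‖ ≤ D - δ`, the inner case forces `D > 1`. Then `D² - D ≥ D²/2 ≥ ‖z‖²/2`, which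
    -- leaves room for the factor `11 / 10` when `|m| = 1`.
    have hD2 : (2 : ℝ) ≤ D := by
      have : (1 : ℝ) < D := by linarith
      exact_mod_cast (show 1 < D by exact_mod_cast this)
    rintro ⟨m, n⟩ hs hp ⟨t, rfl⟩
    have hl10 : l₂ * ‖z‖ ≤ 11 / 10 * ‖z‖ := by gcongr; exact min_le_right _ _
    rcases eq_or_ne m 0 with rfl | hm
    · have ht : t ≠ 0 := by rintro rfl; exact hp (by simp)
      have ht1 : (1 : ℝ) ≤ |(t : ℝ)| := by exact_mod_cast Int.one_le_abs ht
      have : l₂ * ‖z‖ ≤ D := by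
        calc l₂ * ‖z‖ ≤ D / (D - δ) * (D - δ) := by
              refine mul_le_mul (min_le_left _ _) hzD (norm_nonneg _) (div_nonneg ?_ ?_) <;>
                linarith
          _ = D := div_mul_cancel₀ _ (by linarith)
      refine this.trans ?_
      simp only [Int.cast_zero, zero_mul, zero_add, Int.cast_mul, Int.cast_natCast, norm_mul,
        Complex.norm_natCast, Complex.norm_intCast]
      nlinarith
    · refine hl10.trans (le_of_sq_le_sq ?_ (norm_nonneg _))
      rw [norm_sq_lattice]
      have h1 := abs_mul_re_le hz2 m ((D * t : ℤ) : ℝ)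
      have hm1 : (1 : ℝ) ≤ |(m : ℝ)| := by exact_mod_cast Int.one_le_abs hm
      by_cases hm2 : 2 ≤ |m|
      · have hm2' : (2 : ℝ) ≤ |(m : ℝ)| := by exact_mod_cast hm2
        rw [← sq_abs (m : ℝ), ← sq_abs ((D * t : ℤ) : ℝ)]
        have : ‖z‖ ^ 2 ≥ 1 := by nlinarith
        nlinarith [sq_nonneg (|(m : ℝ)| - 2 * |((D * t : ℤ) : ℝ)|), mul_le_mul hm2' hm2' (by norm_num) (by positivity)]
      · have hm1' : |m| = 1 := le_antisymm (by omega) (Int.one_le_abs hm)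
        have hm' : |(m : ℝ)| = 1 := by exact_mod_cast hm1'
        have ht : t ≠ 0 := by
          rintro rfl
          apply hs
          rcases (abs_eq one_pos.le).1 hm1' with rfl | rfl <;> simp
        have ht1 : (1 : ℝ) ≤ |(t : ℝ)| := by exact_mod_cast Int.one_le_abs ht
        have hn : (D : ℝ) ≤ |((D * t : ℤ) : ℝ)| := by
          push_cast
          rw [abs_mul, Nat.abs_cast]
          nlinarith
        rw [← sq_abs (m : ℝ), ← sq_abs ((D * t : ℤ) : ℝ)]
        rw [hm'] at h1 ⊢
        have : ‖z‖ ^ 2 ≤ D ^ 2 := by gcongr; linarith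
        nlinarith
  · refine latticeSum_ne_zero_of_dominant hc hzU hk4 (ρ := D) (by linarith) le_rfl
      (by linarith) {(0, (D : ℤ)), (0, -(D : ℤ))} ?_ ?_ hk1 h0
    · rw [sum_latticeTerm_horizontal hc hD hk]; simp
    have hl : l₁ * D = D + δ := div_mul_cancel₀ _ (by linarith)
    rintro ⟨m, n⟩ hs hp ⟨t, rfl⟩
    rw [hl]
    rcases eq_or_ne m 0 with rfl | hm
    · have ht : 2 ≤ |t| := by
        by_contra! h
        have : t = 0 ∨ t = 1 ∨ t = -1 := by
          have := abs_lt.1 h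
          omega
        rcases this with rfl | rfl | rfl
        · exact hp (by simp)
        · simp at hs
        · simp at hs
      have ht1 : (2 : ℝ) ≤ |(t : ℝ)| := by exact_mod_cast ht
      simp only [Int.cast_zero, zero_mul, zero_add, Int.cast_mul, Int.cast_natCast, norm_mul,
        Complex.norm_natCast, Complex.norm_intCast]
      nlinarith
    -- In the fundamental domain `z` is shortest among the vectors with `m ≠ 0`: with `a = |m|`, `b
    -- = |n|` the excess is at least `a² - ab + b² - 1 ≥ 0`.
    · refine (show D + δ ≤ ‖z‖ by linarith).trans (le_of_sq_le_sq ?_ (norm_nonneg _))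
      rw [norm_sq_lattice]
      have h1 := abs_mul_re_le hz2 m ((D * t : ℤ) : ℝ)
      have hm1 : (1 : ℝ) ≤ |(m : ℝ)| := by exact_mod_cast Int.one_le_abs hm
      have hn : |((D * t : ℤ) : ℝ)| = 0 ∨ (1 : ℝ) ≤ |((D * t : ℤ) : ℝ)| := by
        rcases eq_or_ne (D * t : ℤ) 0 with h | h
        · left; rw [h]; simp
        · right; exact_mod_cast Int.one_le_abs h
      have hz3 : ‖z‖ ^ 2 ≥ 1 := by nlinarith
      rw [← sq_abs (m : ℝ), ← sq_abs ((D * t : ℤ) : ℝ)]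
      generalize |((D * t : ℤ) : ℝ)| = b at *
      generalize |(m : ℝ)| = a at *
      have : (a ^ 2 - 1) * 1 ≤ (a ^ 2 - 1) * ‖z‖ ^ 2 := by
        apply mul_le_mul_of_nonneg_left hz3; nlinarith
      rcases hn with rfl | hn
      · nlinarith
      · nlinarith [sq_nonneg (a - b), mul_nonneg (sub_nonneg.2 hm1) (sub_nonneg.2 hn)]

/-! ### Existence of zeros near the circle of radius `D`. -/

/-- Among the logarithms of `exp a` there is one near `k • l` if `l` is imaginary. -/
theorem exists_exp_mul_eq {a l : ℂ} (hl : l.re = 0) (hk : k ≠ 0) :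
    ∃ w : ℂ, Complex.exp (k * w) = Complex.exp a ∧ ‖w - l‖ ≤ (‖a‖ + Real.pi) / k := by
  -- Rounding puts the imaginary part of `a + 2πij` within `π` of that of `k * l`; the real parts
  -- differ by `a.re`.
  set θ : ℝ := (k * l - a).im / (2 * Real.pi) with hθ
  set j : ℤ := round θ
  have hk0 : (k : ℂ) ≠ 0 := by exact_mod_cast hk
  have hkpos : (0 : ℝ) < k := by exact_mod_cast Nat.pos_of_ne_zero hk
  have hπ := Real.pi_pos
  refine ⟨(a + j * (2 * Real.pi * Complex.I)) / k, ?_, ?_⟩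
  · rw [mul_div_cancel₀ _ hk0, Complex.exp_periodic.int_mul j a]
  · rw [div_sub' hk0, norm_div, Complex.norm_natCast]
    gcongr
    refine (Complex.norm_le_abs_re_add_abs_im _).trans (add_le_add ?_ ?_)
    · have : (a + j * (2 * Real.pi * Complex.I) - k * l).re = a.re := by simp [hl]
      rw [this]
      exact Complex.abs_re_le_norm a
    · have : (a + j * (2 * Real.pi * Complex.I) - k * l).im = -(2 * Real.pi * (θ - j)) := by
        rw [hθ]
        field_simp
        simp
        ring
      rw [this, abs_neg, abs_mul, abs_of_pos (by positivity)]
      have := abs_sub_round θ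
      nlinarith

theorem quarter_le_norm_exp_sub_one {ζ : ℂ} (h : ‖ζ‖ = 1 / 2) : 1 / 4 ≤ ‖1 - Complex.exp ζ‖ := by
  have h1 := Complex.norm_exp_sub_one_sub_id_le (x := ζ) (by rw [h]; norm_num)
  have h2 : ‖ζ‖ ≤ ‖1 - Complex.exp ζ‖ + ‖Complex.exp ζ - 1 - ζ‖ := by
    have : ζ = -((1 - Complex.exp ζ) + (Complex.exp ζ - 1 - ζ)) := by ring
    calc ‖ζ‖ = ‖(1 - Complex.exp ζ) + (Complex.exp ζ - 1 - ζ)‖ := by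
          conv_lhs => rw [this, norm_neg]
      _ ≤ _ := norm_add_le _ _
  rw [h] at h1 h2
  linarith

/-- A function close to `1 - exp` (up to a factor) on the unit disc has a zero there. -/
theorem exists_zero_of_near_one_sub_exp {g : ℂ → ℂ} {b : ℂ} (hb : b ≠ 0)
    (hg : DifferentiableOn ℂ g (Metric.ball 0 1))
    (h : ∀ ζ ∈ Metric.ball (0 : ℂ) 1, ‖g ζ - b * (1 - Complex.exp ζ)‖ ≤ ‖b‖ / 20) :
    ∃ ζ ∈ Metric.ball (0 : ℂ) 1, g ζ = 0 := by
  have hb0 := norm_pos_iff.2 hb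
  have hsub : Metric.closedBall (0 : ℂ) (1 / 2) ⊆ Metric.ball 0 1 :=
    Metric.closedBall_subset_ball (by norm_num)
  have h0 : ‖g 0‖ ≤ ‖b‖ / 20 := by simpa using h 0 (by simp)
  have hsph : ∀ ζ ∈ Metric.sphere (0 : ℂ) (1 / 2), ‖b‖ * (3 / 20) ≤ ‖g ζ - g 0‖ := by
    intro ζ hζ
    have h1 := h ζ (hsub (Metric.sphere_subset_closedBall hζ))
    have h2 := quarter_le_norm_exp_sub_one (by simpa using hζ)
    have h3 : ‖b * (1 - Complex.exp ζ)‖ ≤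
        ‖g ζ - g 0‖ + ‖g 0‖ + ‖g ζ - b * (1 - Complex.exp ζ)‖ := by
      have : b * (1 - Complex.exp ζ) =
          (g ζ - g 0) + g 0 - (g ζ - b * (1 - Complex.exp ζ)) := by ring
      rw [this]
      refine (norm_sub_le _ _).trans ?_
      rw [← this]
      gcongr
      exact norm_add_le _ _
    rw [norm_mul] at h3
    nlinarith
  have hd : DiffContOnCl ℂ g (Metric.ball 0 (1 / 2)) := by
    apply DifferentiableOn.diffContOnCl
    rw [closure_ball _ (by norm_num)]
    exact hg.mono hsub
  have hfreq : ∃ᶠ ζ in 𝓝 (0 : ℂ), g ζ ≠ g 0 := by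
    intro hev
    simp only [not_not] at hev
    have := (hg.analyticOnNhd Metric.isOpen_ball).eqOn_of_preconnected_of_eventuallyEq
      (analyticOnNhd_const (v := g 0)) (convex_ball (0 : ℂ) 1).isPreconnected
      (by simp : (0 : ℂ) ∈ Metric.ball (0 : ℂ) 1) hev
    have hm : (1 / 2 : ℂ) ∈ Metric.sphere (0 : ℂ) (1 / 2) := by simp
    have h1 := hsph _ hm
    rw [this (hsub (Metric.sphere_subset_closedBall hm)), sub_self, norm_zero] at h1
    linarith
  -- Quantitative open mapping: the image contains the ball of radius `3‖b‖/40` about `g 0`, and `‖g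
  -- 0‖ ≤ 2‖b‖/40`.
  have := hd.ball_subset_image_closedBall (by norm_num) hsph hfreq
    (show (0 : ℂ) ∈ _ by rw [Metric.mem_ball, dist_zero_left]; linarith)
  obtain ⟨ζ, hζ, h⟩ := this
  exact ⟨ζ, hsub hζ, h⟩

theorem sum_latticeTerm_four (hc : IsLatticeWeight D c) (hD : D ≠ 0) (hk : Even k) :
    ∑ p ∈ ({(1, 0), (-1, 0)} ∪ {(0, (D : ℤ)), (0, -(D : ℤ))} : Finset (ℤ × ℤ)),
      latticeTerm c k z p = 2 * c 0 / z ^ k + 2 * c D / (D : ℂ) ^ k := by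
  rw [Finset.sum_union (by simp), sum_latticeTerm_vertical hk, sum_latticeTerm_horizontal hc hD hk]

/-- On `Re z = ±1/2` with `D = 1`, one of `z ± 1` is as short as `z`. The margin `e / 2` in the real
part excludes this: for `(±1, ±D)` the squared length is at least `2D² - e/2 - (1 - e)D ≥ D² + e/2`.
-/
theorem le_norm_lattice_of_near_circle (hD : D ≠ 0) {e : ℝ} (he : 0 < e) (he1 : e ≤ 1 / 2)
    (hre : |z.re| ≤ 1 / 2 - e / 2) (hz : (D : ℝ) ^ 2 - e / 2 ≤ ‖z‖ ^ 2) (p : ℤ × ℤ)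
    (hs : p ∉ ({(1, 0), (-1, 0)} ∪ {(0, (D : ℤ)), (0, -(D : ℤ))} : Finset (ℤ × ℤ)))
    (hp : p ≠ 0) (hd : (D : ℤ) ∣ p.2) :
    √((D : ℝ) ^ 2 + e / 2) ≤ ‖(p.1 : ℂ) * z + p.2‖ := by
  have hD1 : (1 : ℝ) ≤ D := by exact_mod_cast Nat.one_le_iff_ne_zero.2 hD
  refine Real.sqrt_le_iff.2 ⟨norm_nonneg _, ?_⟩
  obtain ⟨m, n⟩ := p
  obtain ⟨t, rfl⟩ := hd
  simp only [Finset.mem_union, Finset.mem_insert, Finset.mem_singleton, Prod.mk.injEq,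
    not_or] at hs
  have hn0 : t ≠ 0 → (D : ℝ) ≤ |((D * t : ℤ) : ℝ)| := by
    intro ht
    have ht1 : (1 : ℝ) ≤ |(t : ℝ)| := by exact_mod_cast Int.one_le_abs ht
    push_cast
    rw [abs_mul, Nat.abs_cast]
    nlinarith
  rw [norm_sq_lattice]
  rcases eq_or_ne m 0 with rfl | hm
  · have ht : 2 ≤ |t| := by
      by_contra! h
      have : t = 0 ∨ t = 1 ∨ t = -1 := by
        have := abs_lt.1 h
        omega
      rcases this with rfl | rfl | rfl
      · exact hp (by simp)
      · simp at hs
      · simp at hs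
    have ht1 : (2 : ℝ) ≤ |(t : ℝ)| := by exact_mod_cast ht
    have : (4 : ℝ) ≤ (t : ℝ) ^ 2 := by rw [← sq_abs]; nlinarith
    push_cast
    nlinarith
  · have h1 := abs_mul_re_le hre m ((D * t : ℤ) : ℝ)
    have hm1 : (1 : ℝ) ≤ |(m : ℝ)| := by exact_mod_cast Int.one_le_abs hm
    rw [← sq_abs (m : ℝ), ← sq_abs ((D * t : ℤ) : ℝ)]
    by_cases hm2 : 2 ≤ |m|
    · have hm2' : (2 : ℝ) ≤ |(m : ℝ)| := by exact_mod_cast hm2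
      generalize |((D * t : ℤ) : ℝ)| = b at *
      generalize |(m : ℝ)| = a at *
      have ha : 4 * (‖z‖ ^ 2 - 1 / 4) ≤ a ^ 2 * (‖z‖ ^ 2 - 1 / 4) := by
        apply mul_le_mul_of_nonneg_right <;> nlinarith
      have hb : 0 ≤ e * (a * b) ∨ b < 0 := by
        rcases le_or_gt 0 b with h | h
        · left; positivity
        · right; exact h
      have hb0 : -(2 * (1 / 2 - e / 2) * (a * b)) = -(a * b) + e * (a * b) := by ring
      rcases hb with hb | hb
      · nlinarith [sq_nonneg (a - 2 * b)]
      · have : 0 ≤ -((a * b) * (1 - e)) := by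
          have : 0 ≤ a * (-b) * (1 - e) := by
            apply mul_nonneg (mul_nonneg _ _) <;> linarith
          linarith
        nlinarith [sq_nonneg b]
    · have hm1' : |m| = 1 := le_antisymm (by omega) (Int.one_le_abs hm)
      have hm' : |(m : ℝ)| = 1 := by exact_mod_cast hm1'
      have ht : t ≠ 0 := by
        rintro rfl
        rcases (abs_eq one_pos.le).1 hm1' with rfl | rfl <;> simp at hs
      have hn := hn0 ht
      rw [hm'] at h1 ⊢
      nlinarith

/-- Every interior point of the circle of radius `D` is a limit of zeros. -/
theorem eventually_exists_zero_near (hc : IsLatticeWeight D c) (hD : D ≠ 0) {z₀ : ℂ}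
    (hz₀ : ‖z₀‖ = D) (hre : |z₀.re| < 1 / 2) {V : Set ℂ} (hV : V ∈ 𝓝 z₀) :
    ∀ᶠ k : ℕ in atTop, Even k → ∃ z ∈ V, latticeSum c k z = 0 := by
  have hD1 : (1 : ℝ) ≤ D := by exact_mod_cast Nat.one_le_iff_ne_zero.2 hD
  have hD0 : (D : ℂ) ≠ 0 := by exact_mod_cast hD
  have hz₀0 : z₀ ≠ 0 := by rw [← norm_pos_iff, hz₀]; linarith
  obtain ⟨e, he, he1, hre'⟩ : ∃ e : ℝ, 0 < e ∧ e ≤ 1 / 2 ∧ |z₀.re| < 1 / 2 - e / 2 :=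
    ⟨1 / 2 - |z₀.re|, by linarith, by linarith [abs_nonneg z₀.re], by linarith⟩
  -- `W` reaches slightly inside the circle, hence for `D = 1` outside the fundamental domain;
  -- `wideDomain` makes room for this.
  set W : Set ℂ := {z | |z.re| < 1 / 2 - e / 2 ∧ (D : ℝ) ^ 2 - e / 2 < ‖z‖ ^ 2} with hW
  have hWo : IsOpen W :=
    IsOpen.and (isOpen_lt (by fun_prop) (by fun_prop)) (isOpen_lt (by fun_prop) (by fun_prop))
  have hWz : W ∈ 𝓝 z₀ := hWo.mem_nhds ⟨hre', by rw [hz₀]; linarith⟩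
  have hWU : W ⊆ wideDomain := fun z hz => ⟨by linarith [hz.1], by nlinarith [hz.2]⟩
  set l : ℂ := Complex.log (z₀ / D) with hl
  have hexpl : (D : ℂ) * Complex.exp l = z₀ := by
    rw [hl, Complex.exp_log (div_ne_zero hz₀0 hD0), mul_div_cancel₀ _ hD0]
  have hlre : l.re = 0 := by
    rw [hl, Complex.log_re, norm_div, hz₀, Complex.norm_natCast,
      div_self (by linarith), Real.log_one]
  have hcont : ContinuousAt (fun w : ℂ => (D : ℂ) * Complex.exp w) l := by fun_prop
  have hnh : V ∩ W ∈ 𝓝 ((D : ℂ) * Complex.exp l) := by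
    rw [hexpl]; exact inter_mem hV hWz
  obtain ⟨r, hr, hrsub⟩ := Metric.mem_nhds_iff.1 (hcont hnh)
  set a : ℂ := Complex.log (-(c 0 / c D)) with ha
  have hc0 := hc.zero_ne_zero
  have hcD := hc.self_ne_zero
  have hexpa : Complex.exp a = -(c 0 / c D) :=
    Complex.exp_log (neg_ne_zero.2 (div_ne_zero hc0 hcD))
  set R : ℝ := √((D : ℝ) ^ 2 + e / 2) with hR
  have hDR : (D : ℝ) < R := Real.lt_sqrt_of_sq_lt (by linarith)
  have hR0 : 0 < R := by linarith
  have hkr : ∀ᶠ k : ℕ in atTop, (‖a‖ + Real.pi + 1) / r < k :=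
    tendsto_natCast_atTop_atTop.eventually_gt_atTop _
  filter_upwards [eventually_ge_atTop 4, hkr,
    eventually_div_pow_lt (l := R / D)
      (tailConst * ‖c 0‖ * R ^ 4 * (‖c 0‖ / ‖c D‖) * Real.exp 1)
      ((one_lt_div (by linarith)).2 hDR)
      (show 0 < ‖c 0‖ / 20 by have := norm_pos_iff.2 hc0; positivity)] with k hk4 hkr hkC hk
  have hk0 : k ≠ 0 := by omega
  have hkpos : (0 : ℝ) < k := by exact_mod_cast Nat.pos_of_ne_zero hk0
  have hkC0 : (k : ℂ) ≠ 0 := by exact_mod_cast hk0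
  obtain ⟨w, hw, hwl⟩ := exists_exp_mul_eq (a := a) hlre hk0
  -- Rescaling by `1 / k` makes `Z ζ ^ k` a constant times `exp ζ`. As `k * w` is a logarithm of
  -- `-(c 0 / c D)`, the four main terms multiplied by `Z ζ ^ k / 2` give `c 0 * (1 - exp ζ)`.
  set Z : ℂ → ℂ := fun ζ => (D : ℂ) * Complex.exp (w + ζ / k) with hZ
  have hZmem : ∀ ζ ∈ Metric.ball (0 : ℂ) 1, Z ζ ∈ V ∩ W := by
    intro ζ hζ
    refine hrsub (Metric.mem_ball.2 ?_)
    rw [dist_eq_norm]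
    have h1 : ‖ζ‖ < 1 := by simpa using hζ
    calc ‖w + ζ / k - l‖ = ‖(w - l) + ζ / k‖ := by ring_nf
      _ ≤ ‖w - l‖ + ‖ζ / k‖ := norm_add_le _ _
      _ ≤ (‖a‖ + Real.pi) / k + 1 / k := by
          rw [norm_div, Complex.norm_natCast]
          gcongr
      _ = (‖a‖ + Real.pi + 1) / k := by ring
      _ < r := by
          rw [div_lt_iff₀ hr] at hkr
          rw [div_lt_iff₀ hkpos]; linarith
  have hZpow : ∀ ζ, Z ζ ^ k = (D : ℂ) ^ k * -(c 0 / c D) * Complex.exp ζ := by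
    intro ζ
    rw [hZ, mul_pow, ← Complex.exp_nat_mul, mul_add, mul_div_cancel₀ _ hkC0, Complex.exp_add, hw,
      hexpa]
    ring
  set g : ℂ → ℂ := fun ζ => latticeSum c k (Z ζ) * Z ζ ^ k / 2 with hg
  have hgd : DifferentiableOn ℂ g (Metric.ball 0 1) := by
    have h1 : DifferentiableOn ℂ Z (Metric.ball 0 1) := by
      rw [hZ]; fun_prop
    have h2 := (differentiableOn_latticeSum hc hk4 hWo hWU).comp h1 fun ζ hζ => (hZmem ζ hζ).2
    exact (h2.mul (h1.pow k)).div_const 2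
  have hnear : ∀ ζ ∈ Metric.ball (0 : ℂ) 1,
      ‖g ζ - c 0 * (1 - Complex.exp ζ)‖ ≤ ‖c 0‖ / 20 := by
    intro ζ hζ
    have hne : Z ζ ^ k ≠ 0 := pow_ne_zero _ (mul_ne_zero hD0 (Complex.exp_ne_zero _))
    have hmem := (hZmem ζ hζ).2
    have h1 := norm_latticeSum_sub_le hc (hWU hmem) hk4 hR0
      ({(1, 0), (-1, 0)} ∪ {(0, (D : ℤ)), (0, -(D : ℤ))})
      (le_norm_lattice_of_near_circle hD he he1 hmem.1.le hmem.2.le)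
    rw [sum_latticeTerm_four hc hD hk] at h1
    have h2 : g ζ - c 0 * (1 - Complex.exp ζ) =
        (latticeSum c k (Z ζ) - (2 * c 0 / Z ζ ^ k + 2 * c D / (D : ℂ) ^ k)) *
          (Z ζ ^ k / 2) := by
      have h3 : (2 * c 0 / Z ζ ^ k + 2 * c D / (D : ℂ) ^ k) * (Z ζ ^ k / 2) =
          c 0 * (1 - Complex.exp ζ) := by
        rw [add_mul, div_mul_div_comm, mul_comm (Z ζ ^ k) 2, mul_div_mul_right _ _ hne]
        rw [hZpow]
        field_simp
        ring
      rw [sub_mul, h3, hg]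
      ring
    have h4 : ‖Z ζ ^ k / 2‖ ≤ (D : ℝ) ^ k * (‖c 0‖ / ‖c D‖) * Real.exp 1 := by
      rw [hZpow, norm_div, norm_mul, norm_mul, norm_neg, norm_div, norm_pow, Complex.norm_natCast,
        Complex.norm_exp]
      have h5 : Real.exp ζ.re ≤ Real.exp 1 := by
        apply Real.exp_le_exp.2
        have : ‖ζ‖ < 1 := by simpa using hζ
        linarith [Complex.re_le_norm ζ]
      have h6 : (1 : ℝ) ≤ ‖(2 : ℂ)‖ := by simp
      refine (div_le_self (by positivity) h6).trans ?_
      gcongr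
    have := tailConst_nonneg
    rw [h2, norm_mul]
    calc _ ≤ tailConst * (‖c 0‖ * R ^ 4 / R ^ k) *
          ((D : ℝ) ^ k * (‖c 0‖ / ‖c D‖) * Real.exp 1) :=
          mul_le_mul h1 h4 (norm_nonneg _) (by positivity)
      _ = tailConst * ‖c 0‖ * R ^ 4 * (‖c 0‖ / ‖c D‖) * Real.exp 1 / (R / D) ^ k := by
          rw [div_pow]; field_simp
      _ ≤ _ := hkC.le
  obtain ⟨ζ, hζ, hz⟩ := exists_zero_of_near_one_sub_exp hc0 hgd hnear
  refine ⟨Z ζ, (hZmem ζ hζ).1, ?_⟩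
  have hne : Z ζ ^ k ≠ 0 := pow_ne_zero _ (mul_ne_zero hD0 (Complex.exp_ne_zero _))
  simpa [hg, hne] using hz

/-! ### Moving zeros into the closed fundamental domain. -/

/-- The symmetry of `∑ 1 / (mz + n)^k` under `z ↦ 1 / z̄`. -/
theorem latticeSum_inv_conj (hconst : ∀ n, c n = c 0) (hz : z ≠ 0) (h : latticeSum c k z = 0) :
    latticeSum c k ((starRingEnd ℂ) z)⁻¹ = 0 := by
  have hz' : (starRingEnd ℂ) z ≠ 0 := by simpa using hz
  by_cases hc : c 0 = 0
  · simp [latticeSum, latticeTerm, hconst, hc]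
  -- `m / z̄ + n = (n z̄ + m) / z̄` swaps `m` and `n`, which constant weights permit.
  have key : ∀ p : ℤ × ℤ, latticeTerm c k ((starRingEnd ℂ) z)⁻¹ p =
      c 0 * (starRingEnd ℂ) z ^ k / (starRingEnd ℂ) (c 0) *
        (starRingEnd ℂ) (latticeTerm c k z ((Equiv.prodComm ℤ ℤ) p)) := by
    rintro ⟨m, n⟩
    have hcc : (starRingEnd ℂ) (c 0) ≠ 0 := by simpa using hc
    simp only [latticeTerm, hconst, Equiv.prodComm_apply, Prod.swap_prod_mk, map_div₀, map_pow,
      map_add, map_mul, map_intCast]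
    have : (m : ℂ) * ((starRingEnd ℂ) z)⁻¹ + n =
        ((n : ℂ) * (starRingEnd ℂ) z + m) * ((starRingEnd ℂ) z)⁻¹ := by
      field_simp; ring
    rw [this, mul_pow, inv_pow]
    field_simp
  rw [latticeSum, tsum_congr key, tsum_mul_left,
    (Equiv.prodComm ℤ ℤ).tsum_eq fun p => (starRingEnd ℂ) (latticeTerm c k z p),
    ← Complex.conj_tsum]
  change _ * (starRingEnd ℂ) (latticeSum c k z) = 0
  rw [h, map_zero, mul_zero]

/-- For `D > 1` a neighbourhood of `z₀` lies in `‖z‖ > 1`. For `D = 1` a zero inside the unit disc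
is reflected by `z ↦ 1 / z̄`, which fixes `z₀`; this is why constant weights are required there. -/
theorem eventually_exists_zero_closedFundDomain (hc : IsLatticeWeight D c) (hD : D ≠ 0)
    (hconst : D = 1 → ∀ n, c n = c 0) {z₀ : ℂ} (hz₀ : z₀ ∈ arc D) (hre : |z₀.re| < 1 / 2)
    {ε : ℝ} (hε : 0 < ε) :
    ∀ᶠ k : ℕ in atTop, Even k → ∃ z ∈ closedFundDomain, dist z z₀ < ε ∧ latticeSum c k z = 0 := by
  obtain ⟨⟨him, h1, -⟩, hnorm⟩ := hz₀
  set V : Set ℂ := {z | 0 < z.im ∧ |z.re| < 1 / 2 ∧ dist z z₀ < ε} with hV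
  have hVo : IsOpen V := IsOpen.and (isOpen_lt (by fun_prop) (by fun_prop))
    (IsOpen.and (isOpen_lt (by fun_prop) (by fun_prop)) (isOpen_lt (by fun_prop) (by fun_prop)))
  have hVz : V ∈ 𝓝 z₀ := hVo.mem_nhds ⟨him, hre, by simpa using hε⟩
  by_cases hD1 : D = 1
  · subst hD1
    have hz0 : z₀ ≠ 0 := by rw [← norm_pos_iff]; linarith
    have hc0 : (starRingEnd ℂ) z₀ ≠ 0 := by simpa using hz0
    have hinv : ((starRingEnd ℂ) z₀)⁻¹ = z₀ := by
      rw [inv_eq_iff_eq_inv, eq_comm]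
      apply inv_eq_of_mul_eq_one_right
      rw [Complex.mul_conj, Complex.normSq_eq_norm_sq, hnorm]
      simp
    have hcont : ContinuousAt (fun z : ℂ => ((starRingEnd ℂ) z)⁻¹) z₀ :=
      (Complex.continuous_conj.continuousAt).inv₀ hc0
    have hV2 : V ∩ (fun z : ℂ => ((starRingEnd ℂ) z)⁻¹) ⁻¹' V ∈ 𝓝 z₀ :=
      inter_mem hVz (hcont (by simpa only [hinv] using hVz))
    filter_upwards [eventually_exists_zero_near hc hD hnorm hre hV2] with k hk hke
    obtain ⟨z, ⟨hz, hz'⟩, h0⟩ := hk hke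
    rcases le_or_gt 1 ‖z‖ with h | h
    · exact ⟨z, ⟨hz.1, h, hz.2.1.le⟩, hz.2.2, h0⟩
    · have hzne : z ≠ 0 := by rintro rfl; simp [hV] at hz
      refine ⟨_, ⟨hz'.1, ?_, hz'.2.1.le⟩, hz'.2.2,
        latticeSum_inv_conj (hconst rfl) hzne h0⟩
      rw [norm_inv, Complex.norm_conj]
      exact (one_le_inv₀ (norm_pos_iff.2 hzne)).2 h.le
  · have hD2 : (1 : ℝ) < D := by exact_mod_cast (show 1 < D by omega)
    have hW : {z : ℂ | 1 < ‖z‖} ∈ 𝓝 z₀ :=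
      (isOpen_lt continuous_const continuous_norm).mem_nhds (by simpa [hnorm] using hD2)
    filter_upwards [eventually_exists_zero_near hc hD hnorm hre (inter_mem hVz hW)] with k hk hke
    obtain ⟨z, ⟨hz, hz'⟩, h0⟩ := hk hke
    exact ⟨z, ⟨hz.1, le_of_lt hz', hz.2.1.le⟩, hz.2.2, h0⟩

/-! ### The trace form as a lattice sum. -/

theorem summable_latticeTerm_of_norm_eq_one {c : ℤ → ℂ} (hc : ∀ n, ‖c n‖ = 1) {k : ℕ}
    (hk : 4 ≤ k) {z : ℂ} (hz : z ∈ wideDomain) : Summable (latticeTerm c k z) := by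
  have h1 : IsLatticeWeight 1 fun _ => (1 : ℂ) :=
    ⟨fun _ => le_rfl, fun _ => rfl, fun n => by simp⟩
  refine Summable.of_norm_bounded (summable_latticeTerm h1 hz hk).norm fun p => le_of_eq ?_
  simp [latticeTerm, hc]

theorem eis_eq_latticeSum (N : ℕ) [NeZero N] {k : ℕ} (hk : k ≠ 0) (a : ZMod N)
    {v : Fin 2 → ZMod N} (h0 : v 0 = a) (h1 : v 1 = 0) (z : ℂ) :
    eis N k v z = latticeSum (fun n => ZMod.stdAddChar (a * (n : ZMod N))) k z := by
  have hsupp : Function.support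
      (latticeTerm (fun n => ZMod.stdAddChar (a * (n : ZMod N))) k z) ⊆ {p | p ≠ (0, 0)} := by
    rintro p hp rfl
    apply hp
    simp [latticeTerm, hk]
  rw [latticeSum, ← tsum_subtype_eq_of_support_subset hsupp]
  simp only [eis, h0, h1, zero_mul, sub_zero]
  rfl

/-- Modulo `N`, `(A, 0)g = (A g₀₀, 0)`, so the character involves only `n`, and the finite sum over
`g` moves inside the absolutely convergent series. -/
theorem eisTrace_eq_latticeSum (N : ℕ) [NeZero N] {k : ℕ} (hk : 4 ≤ k) (A : ZMod N) {z : ℂ}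
    (hz : z ∈ wideDomain) :
    eisTrace N (GammaUpper0 N) k ![A, 0] z = latticeSum (traceCoeff N A) k z := by
  classical
  have hk0 : k ≠ 0 := by omega
  rw [eisTrace, Finset.sum_congr rfl fun g _ =>
    eis_eq_latticeSum N hk0 (A * g.1 0 0) (v := ![A, 0] ᵥ* (g.1 : Matrix (Fin 2) (Fin 2) (ZMod N)))
      (by simp [Matrix.vecMul, dotProduct, Fin.sum_univ_two])
      (by simp [Matrix.vecMul, dotProduct, Fin.sum_univ_two, reduction_zero_one]) z]
  simp only [latticeSum]
  rw [← Summable.tsum_finsetSum fun g _ => summable_latticeTerm_of_norm_eq_one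
    (fun n => by rw [ZMod.stdAddChar_apply]; exact Circle.norm_coe _) hk hz]
  refine tsum_congr fun p => ?_
  simp only [latticeTerm, traceCoeff, Finset.sum_div]

/-! ### Geometry of the arcs. -/

theorem isClosed_closedFundDomain : IsClosed closedFundDomain := by
  have h : closedFundDomain = {z : ℂ | 0 ≤ z.im ∧ 1 ≤ ‖z‖ ∧ |z.re| ≤ 1 / 2} := by
    ext z
    refine ⟨fun h => ⟨h.1.le, h.2⟩, fun h => ⟨lt_of_le_of_ne h.1 fun h0 => ?_, h.2⟩⟩
    have h1 := Complex.norm_le_abs_re_add_abs_im z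
    rw [← h0, abs_zero] at h1
    linarith [h.2.1, h.2.2]
  rw [h]
  exact IsClosed.and (isClosed_le continuous_const Complex.continuous_im)
    (IsClosed.and (isClosed_le continuous_const continuous_norm)
      (isClosed_le Complex.continuous_re.abs continuous_const))

theorem isCompact_arc (d : ℝ) : IsCompact (arc d) := by
  have h : arc d = Metric.sphere (0 : ℂ) d ∩ closedFundDomain := by
    ext z
    simp [arc, and_comm]
  rw [h]
  exact (isCompact_sphere 0 d).inter_right isClosed_closedFundDomain

theorem mk_sqrt_mem_arc {d x : ℝ} (hd : 1 ≤ d) (hx : |x| ≤ 1 / 2) :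
    (⟨x, √(d ^ 2 - x ^ 2)⟩ : ℂ) ∈ arc d := by
  have hx2 : x ^ 2 ≤ 1 / 4 := by rw [← sq_abs]; nlinarith [abs_nonneg x]
  have hpos : 0 < d ^ 2 - x ^ 2 := by nlinarith
  have hn : ‖(⟨x, √(d ^ 2 - x ^ 2)⟩ : ℂ)‖ = d := by
    rw [← sq_eq_sq₀ (norm_nonneg _) (by linarith), norm_sq_eq]
    simp only [Real.sq_sqrt hpos.le]
    ring
  exact ⟨⟨Real.sqrt_pos.2 hpos, by rw [hn]; exact hd, hx⟩, hn⟩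

/-- Move `z` vertically to height `s`: then `|z.im - s| (z.im + s) = |‖z‖ - d| (‖z‖ + d)`, while
`‖z‖ ≤ 2 z.im` and `d ≤ 2 s`. -/
theorem exists_mem_arc_dist_le {d : ℝ} (hd : 1 ≤ d) {z : ℂ} (hz : z ∈ closedFundDomain) :
    ∃ w ∈ arc d, dist z w ≤ 2 * |‖z‖ - d| := by
  obtain ⟨him, h1, hre⟩ := hz
  refine ⟨_, mk_sqrt_mem_arc hd hre, ?_⟩
  have hx2 : z.re ^ 2 ≤ 1 / 4 := by rw [← sq_abs]; nlinarith [abs_nonneg z.re]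
  have hz2 := norm_sq_eq z
  set s := √(d ^ 2 - z.re ^ 2) with hs
  have hs2 : s ^ 2 = d ^ 2 - z.re ^ 2 := Real.sq_sqrt (by nlinarith)
  have hs0 : 0 ≤ s := Real.sqrt_nonneg _
  have hds : d ≤ 2 * s := le_of_sq_le_sq (by nlinarith) (by linarith)
  have hzy : ‖z‖ ≤ 2 * z.im := le_of_sq_le_sq (by nlinarith) (by linarith)
  have hdist : dist z ⟨z.re, s⟩ = |z.im - s| := by
    rw [Complex.dist_of_re_eq (by rfl), Real.dist_eq]
  rw [hdist]
  have hmul : |z.im - s| * (z.im + s) = |‖z‖ - d| * (‖z‖ + d) := by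
    rw [← abs_of_pos (show 0 < z.im + s by linarith), ← abs_mul,
      ← abs_of_pos (show 0 < ‖z‖ + d by linarith), ← abs_mul]
    congr 1
    nlinarith
  have hle : |‖z‖ - d| * (‖z‖ + d) ≤ |‖z‖ - d| * (2 * (z.im + s)) := by
    gcongr; linarith
  refine le_of_mul_le_mul_right ?_ (show 0 < z.im + s by linarith)
  linarith

/-- Zeros are constructed only near points with `|re| < 1/2`; shrinking the real part along the arc
reaches its endpoints by continuity. -/
theorem exists_mem_arc_re_lt {d : ℝ} (hd : 1 ≤ d) {z : ℂ} (hz : z ∈ arc d) {ε : ℝ}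
    (hε : 0 < ε) : ∃ w ∈ arc d, |w.re| < 1 / 2 ∧ dist z w < ε := by
  obtain ⟨⟨him, -, hre⟩, hn⟩ := hz
  have him2 : √(d ^ 2 - (1 * z.re) ^ 2) = z.im := by
    rw [← hn, norm_sq_eq, one_mul, add_sub_cancel_left, Real.sqrt_sq him.le]
  have hcont : Tendsto (fun s : ℝ => |√(d ^ 2 - (s * z.re) ^ 2) - z.im| + |s * z.re - z.re|)
      (𝓝[<] 1) (𝓝 0) := by
    have : Continuous fun s : ℝ => |√(d ^ 2 - (s * z.re) ^ 2) - z.im| + |s * z.re - z.re| := by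
      fun_prop
    have h := (this.tendsto 1).mono_left (nhdsWithin_le_nhds (s := Set.Iio 1))
    rwa [him2, sub_self, one_mul, sub_self, abs_zero, add_zero] at h
  obtain ⟨s, hs, hs0, hs1⟩ := ((hcont.eventually (gt_mem_nhds hε)).and
    (Ioo_mem_nhdsLT (show (0 : ℝ) < 1 by norm_num))).exists
  have hlt : |s * z.re| < 1 / 2 := by
    rw [abs_mul, abs_of_pos hs0]
    nlinarith [abs_nonneg z.re]
  refine ⟨_, mk_sqrt_mem_arc hd hlt.le, hlt, ?_⟩
  rw [dist_comm, dist_eq_norm]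
  refine (Complex.norm_le_abs_re_add_abs_im _).trans_lt ?_
  simpa [add_comm] using hs

theorem arc_nonempty {d : ℝ} (hd : 1 ≤ d) : (arc d).Nonempty :=
  ⟨_, mk_sqrt_mem_arc hd (x := 0) (by norm_num)⟩

/-! ### Hausdorff convergence to the union of arcs. -/

open UniqueFactorizationMonoid in
theorem exists_isLatticeWeight {N m : ℕ} [NeZero N] (hm : m ∣ N / radical N) :
    ∃ A : ZMod N, IsLatticeWeight m (traceCoeff N A) ∧
      (m = 1 → ∀ n, traceCoeff N A n = traceCoeff N A 0) := by
  by_cases h1 : m = 1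
  -- Other `A` of squarefree order also give `m = 1`, but `A = 0` ensures the constant weight that
  -- the reflection needs.
  · refine ⟨0, ?_, fun _ => traceCoeff_zero_left N⟩
    simpa [h1] using isLatticeWeight_traceCoeff N 0
  · obtain ⟨A, hA⟩ := exists_addOrderOf_div_radical hm
    exact ⟨A, hA ▸ isLatticeWeight_traceCoeff N A, fun h => absurd h h1⟩

open UniqueFactorizationMonoid in
/-- The limit of the zero sets: the union of the arcs of radius `m ∣ N / rad(N)`. -/
def limitSet (N : ℕ) : Set ℂ := ⋃ m ∈ (N / radical N).divisors, arc (m : ℝ)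

open UniqueFactorizationMonoid in
theorem div_radical_ne_zero (N : ℕ) [NeZero N] : N / radical N ≠ 0 :=
  (Nat.div_pos (Nat.radical_le_self_iff.2 (NeZero.ne N)) (Nat.radical_pos N)).ne'

open UniqueFactorizationMonoid in
theorem mem_limitSet {N : ℕ} [NeZero N] {z : ℂ} :
    z ∈ limitSet N ↔ ∃ m : ℕ, m ∣ N / radical N ∧ z ∈ arc (m : ℝ) := by
  simp [limitSet, div_radical_ne_zero N]

theorem isCompact_limitSet (N : ℕ) : IsCompact (limitSet N) :=
  Finset.isCompact_biUnion _ fun m _ => isCompact_arc m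

open UniqueFactorizationMonoid in
theorem ne_zero_of_dvd_div_radical {N m : ℕ} [NeZero N] (hm : m ∣ N / radical N) : m ≠ 0 := by
  rintro rfl
  exact div_radical_ne_zero N (zero_dvd_iff.1 hm)

open UniqueFactorizationMonoid in
theorem eventually_zeroSet_near_limitSet (N : ℕ) [NeZero N] {ε : ℝ} (hε : 0 < ε) :
    ∀ᶠ k : ℕ in atTop, Even k → ∀ z ∈ zeroSet N k, ∃ w ∈ limitSet N, dist z w ≤ ε := by
  have hd : ∀ A : ZMod N, addOrderOf A / radical (addOrderOf A) ∣ N / radical N := fun A =>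
    div_radical_dvd_div_radical (NeZero.ne N) (addOrderOf_zmod_dvd A)
  have hδ : 0 < min (1 / 2) (ε / 2) := by positivity
  have h := eventually_all.2 fun A : ZMod N =>
    eventually_latticeSum_ne_zero (isLatticeWeight_traceCoeff N A)
      (ne_zero_of_dvd_div_radical (hd A)) hδ
      ((min_le_left _ _).trans_lt (by norm_num))
  filter_upwards [h, eventually_ge_atTop 4] with k hk hk4 hke z ⟨hz, A, hA⟩
  rw [eisTrace_eq_latticeSum N hk4 A (closedFundDomain_subset_wideDomain hz)] at hA
  have h1 := hk A hke z hz hA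
  have hD : (1 : ℝ) ≤ (addOrderOf A / radical (addOrderOf A) : ℕ) := by
    exact_mod_cast Nat.one_le_iff_ne_zero.2 (ne_zero_of_dvd_div_radical (hd A))
  obtain ⟨w, hw, hzw⟩ := exists_mem_arc_dist_le hD hz
  exact ⟨w, mem_limitSet.2 ⟨_, hd A, hw⟩, by linarith [min_le_right (1 / 2) (ε / 2)]⟩

theorem eventually_limitSet_near_zeroSet (N : ℕ) [NeZero N] {ε : ℝ} (hε : 0 < ε) :
    ∀ᶠ k : ℕ in atTop, Even k → ∀ w ∈ limitSet N, ∃ z ∈ zeroSet N k, dist w z ≤ ε := by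
  -- The threshold for `k` depends on the point approximated, so compactness reduces to a finite `ε
  -- / 3`-net.
  obtain ⟨t, htL, htf, hcov⟩ :=
    (isCompact_limitSet N).finite_cover_balls (show 0 < ε / 3 by positivity)
  have hnear : ∀ y ∈ t, ∀ᶠ k : ℕ in atTop, Even k → ∃ z ∈ zeroSet N k,
      dist y z ≤ 2 * ε / 3 := by
    intro y hy
    obtain ⟨m, hm, hym⟩ := mem_limitSet.1 (htL hy)
    have hm0 := ne_zero_of_dvd_div_radical hm
    obtain ⟨y', hy', hre, hdist⟩ := exists_mem_arc_re_lt
      (by exact_mod_cast Nat.one_le_iff_ne_zero.2 hm0) hym (show 0 < ε / 3 by positivity)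
    obtain ⟨A, hA, hA1⟩ := exists_isLatticeWeight hm
    filter_upwards [eventually_exists_zero_closedFundDomain hA hm0 hA1 hy' hre
      (show 0 < ε / 3 by positivity), eventually_ge_atTop 4] with k hk hk4 hke
    obtain ⟨z, hz, hzy, h0⟩ := hk hke
    refine ⟨z, ⟨hz, A, ?_⟩, ?_⟩
    · rwa [eisTrace_eq_latticeSum N hk4 A (closedFundDomain_subset_wideDomain hz)]
    · have := dist_triangle_right y z y'
      linarith
  filter_upwards [(eventually_all_finite htf).2 hnear] with k hk hke w hw
  obtain ⟨y, hy, hwy⟩ := Set.mem_iUnion₂.1 (hcov hw)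
  obtain ⟨z, hz, hyz⟩ := hk y hy hke
  refine ⟨z, hz, (dist_triangle w y z).trans ?_⟩
  rw [Metric.mem_ball] at hwy
  linarith

theorem isHausdorffLimitEven_zeroSet (N : ℕ) [NeZero N] :
    IsHausdorffLimitEven (zeroSet N) (limitSet N) := by
  refine ⟨(isCompact_limitSet N).isClosed, ?_, ?_⟩
  · obtain ⟨z, hz⟩ := arc_nonempty le_rfl
    exact ⟨z, mem_limitSet.2 ⟨1, one_dvd _, by simpa using hz⟩⟩
  · rw [ENNReal.tendsto_nhds_zero]
    intro ε hε
    obtain ⟨r, hr0, hr⟩ := ENNReal.lt_iff_exists_nnreal_btwn.1 hε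
    have hr0' : (0 : ℝ) < r := by exact_mod_cast hr0
    rw [eventually_inf_principal]
    filter_upwards [eventually_zeroSet_near_limitSet N hr0',
      eventually_limitSet_near_zeroSet N hr0'] with k h1 h2 hke
    refine (Metric.hausdorffEDist_le_of_mem_edist (r := (r : ENNReal)) ?_ ?_).trans hr.le
    · intro z hz
      obtain ⟨w, hw, h⟩ := h1 hke z hz
      exact ⟨w, hw, edist_le_coe.2 h⟩
    · intro w hw
      obtain ⟨z, hz, h⟩ := h2 hke w hw
      exact ⟨z, hz, edist_le_coe.2 h⟩

end EisZeros

theorem mainTheorem10 (N : ℕ) [NeZero N] :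
    ∃ L : Set ℂ, EisZeros.IsHausdorffLimitEven (EisZeros.zeroSet N) L ∧
      ∀ d : ℝ, 1 ≤ d →
        (EisZeros.arc d ⊆ L ↔
          ∃ m : ℕ, (m : ℝ) = d ∧ m ∣ N / UniqueFactorizationMonoid.radical N) := by
  refine ⟨_, EisZeros.isHausdorffLimitEven_zeroSet N, fun d hd => ⟨fun h => ?_, ?_⟩⟩
  -- One point of the arc suffices, since its norm determines the radius.
  · obtain ⟨z, hz⟩ := EisZeros.arc_nonempty hd
    obtain ⟨m, hm, hzm⟩ := EisZeros.mem_limitSet.1 (h hz)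
    exact ⟨m, hzm.2.symm.trans hz.2, hm⟩
  · rintro ⟨m, rfl, hm⟩ z hz
    exact EisZeros.mem_limitSet.2 ⟨m, hm, hz⟩
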